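/- Let $n\geq 2$. *Orders.* For a poset $D$ with order $\sqsubseteq$, let $\uparrow\! x=\{y\in D: x\sqsubseteq y\}$ and $\max(D)=\{x\in D:\ \uparrow\! x=\{x\}\}$. An element $x\in D$ is irreducible if $x$ is the greatest lower bound of $\uparrow\! x\cap\max(D)$; $\mathrm{Ir}(D)$ is the set of irreducible elements with the order inherited from $D$, and $D^*$ denotes the order dual of $D$. *Classical states.* Let $\Delta^n=\{x\in[0,1]^n:\sum_{i=1}^n x_i=1\}$. For $x\in\Delta^{n+1}$ with $x_i\neq 1$ let $p_i(x)=\frac{1}{1-x_i}(x_1,\dots,\widehat{x_i},\dots,x_{n+1})\in\Delta^n$. The Bayesian order on $\Delta^n$ is defined inductively: for $x,y\in\Delta^2$, $x\sqsubseteq y$ iff $y_1\le x_1\le \frac12$ or $\frac12\le x_1\le y_1$; for $n\ge 2$ and $x,y\in\Delta^{n+1}$, $x\sqsubseteq y$ iff $p_i(x)\sqsubseteq p_i(y)$ for all $i$ with $x_i\ne 1$ and $y_i\neq 1$. *Quantum states.* Let $\mathcal H^n$ be an $n$-dimensional complex Hilbert space and let $\Omega^n$ be the set of density operators on $\mathcal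 H^n$ (self-adjoint positive linear operators of trace $1$). For a self-adjoint operator $e$ on $\mathcal H^n$ with spectrum $\{1,\dots,n\}$, let $p_e^i$ be the orthogonal projection onto the eigenspace of $e$ for the eigenvalue $i$, and for $\rho\in\Omega^n$ put $\mathrm{spec}(\rho|e)=(\mathrm{tr}(p_e^1\rho),\dots,\mathrm{tr}(p_e^n\rho))\in\Delta^n$. The spectral order on $\Omega^n$ is: $\rho\sqsubseteq\sigma$ iff there is such an $e$ with $\rho e=e\rho$, $\sigma e=e\sigma$ and $\mathrm{spec}(\rho|e)\sqsubseteq\mathrm{spec}(\sigma|e)$ in the Bayesian order. **Theorem.** There are order isomorphisms $$\mathrm{Ir}(\Delta^n)^*\simeq\mathcal P\{1,\dots,n\}\setminus\{\emptyset\}\qquad\text{and}\qquad \mathrm{Ir}(\Omega^n)^*\simeq\mathbb L^n\setminus\{0\},$$ where the subsets of $\{1,\dots,n\}$ and the lattice $\mathbb L^n$ of linear subspaces of $\mathcal H^n$ are ordered by inclusion. -/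

import Mathlib

noncomputable section

namespace StateDomains

/-! ## Order-theoretic notions -/

/-- The maximal elements: those `x` with `↑x = {x}`. -/
def maxElements (D : Type*) [LE D] : Set D :=
  {x | {y | x ≤ y} = {x}}

/-- The irreducible elements: those `x` that are the meet (greatest lower bound) of the maximal
elements above `x`. -/
def Ir (D : Type*) [LE D] : Set D :=
  {x | IsGLB ({y | x ≤ y} ∩ maxElements D) x}

/-! ## Classical states and the Bayesian order -/

/-- Classical states: probability vectors `(x₁, …, xₙ)`. -/
@[ext]
structure ClassicalState (n : ℕ) where
  /-- The vector of probabilities. -/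
  prob : Fin n → ℝ
  /-- The entries are nonnegative and sum to one. -/
  mem_simplex : prob ∈ stdSimplex ℝ (Fin n)

namespace ClassicalState

/-- Removing the `i`-th entry and renormalizing gives a classical state if `xᵢ ≠ 1`. -/
theorem bayesianProj_mem {n : ℕ} (i : Fin (n + 1)) (x : ClassicalState (n + 1))
    (hx : x.prob i ≠ 1) :
    (fun j : Fin n => x.prob (i.succAbove j) / (1 - x.prob i)) ∈ stdSimplex ℝ (Fin n) := by
  obtain ⟨h0, h1⟩ := x.mem_simplex
  rw [Fin.sum_univ_succAbove _ i] at h1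
  have hs : 0 ≤ ∑ j : Fin n, x.prob (i.succAbove j) := Finset.sum_nonneg fun j _ => h0 _
  have hne : 1 - x.prob i ≠ 0 := fun h => hx (by linarith)
  refine ⟨fun j => div_nonneg (h0 _) (by linarith), ?_⟩
  rw [← Finset.sum_div, div_eq_one_iff_eq hne]
  linarith

/-- The Bayesian projection `pᵢ`, defined at all states other than the pure state `eᵢ`: remove the
`i`-th entry and renormalize. -/
def bayesianProj {n : ℕ} (i : Fin (n + 1)) (x : ClassicalState (n + 1)) (hx : x.prob i ≠ 1) :
    ClassicalState n where
  prob j := x.prob (i.succAbove j) / (1 - x.prob i)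
  mem_simplex := bayesianProj_mem i x hx

/-- The Bayesian order. It is given explicitly on two-state systems, and inductively through the
Bayesian projections on larger ones. (For fewer than two states, where there is at most one
classical state, the value is the trivial relation.) -/
def bayesianLE : (n : ℕ) → ClassicalState n → ClassicalState n → Prop
  | 0, _, _ => True
  | 1, _, _ => True
  | 2, x, y =>
      (y.prob 0 ≤ x.prob 0 ∧ x.prob 0 ≤ 1 / 2) ∨ (1 / 2 ≤ x.prob 0 ∧ x.prob 0 ≤ y.prob 0)
  | n + 3, x, y =>
      ∀ (i : Fin (n + 3)) (hx : x.prob i ≠ 1) (hy : y.prob i ≠ 1),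
        bayesianLE (n + 2) (bayesianProj i x hx) (bayesianProj i y hy)

/-- Classical states carry the Bayesian order. -/
instance (n : ℕ) : LE (ClassicalState n) := ⟨bayesianLE n⟩

end ClassicalState

/-! ## Quantum states and the spectral order -/

/-- Quantum states: density operators, i.e. self-adjoint positive linear operators of trace one.
(`LinearMap.IsPositive` includes self-adjointness.) -/
@[ext]
structure QuantumState (H : Type*) [NormedAddCommGroup H] [InnerProductSpace ℂ H]
    [FiniteDimensional ℂ H] where
  /-- The density operator. -/
  op : H →ₗ[ℂ] H
  /-- It is self-adjoint and positive. -/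
  isPositive : op.IsPositive
  /-- It has trace one. -/
  trace_eq_one : LinearMap.trace ℂ H op = 1

/-- Quantum observables with spectrum `{1, …, n}`, where `n = dim H`. -/
structure Observable (H : Type*) [NormedAddCommGroup H] [InnerProductSpace ℂ H]
    [FiniteDimensional ℂ H] where
  /-- The operator. -/
  op : H →ₗ[ℂ] H
  /-- It is self-adjoint. -/
  isSymmetric : op.IsSymmetric
  /-- Its spectrum is `{1, …, n}`. -/
  spectrum_eq : spectrum ℂ op =
    Set.range fun i : Fin (Module.finrank ℂ H) => ((i : ℕ) : ℂ) + 1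

variable {H : Type*} [NormedAddCommGroup H] [InnerProductSpace ℂ H] [FiniteDimensional ℂ H]

namespace Observable

/-- The eigenspace of the observable for the eigenvalue `i + 1`, with `i = 0, …, n - 1`. -/
def eigenspace (e : Observable H) (i : Fin (Module.finrank ℂ H)) : Submodule ℂ H :=
  Module.End.eigenspace e.op (((i : ℕ) : ℂ) + 1)

/-- The projection onto the eigenspace for the eigenvalue `i + 1`. -/
def proj (e : Observable H) (i : Fin (Module.finrank ℂ H)) : H →ₗ[ℂ] H :=
  (e.eigenspace i).starProjection.toLinearMap

/-- The probability `tr(p · ρ)` that a measurement of `e` in the state `ρ` yields the value `i + 1`.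
The trace is a real number, so that taking the real part loses nothing. -/
def pr (ρ : QuantumState H) (e : Observable H) (i : Fin (Module.finrank ℂ H)) : ℝ :=
  (LinearMap.trace ℂ H (e.proj i ∘ₗ ρ.op)).re

open scoped ComplexOrder in
theorem trace_proj_comp_nonneg (ρ : QuantumState H) (e : Observable H)
    (i : Fin (Module.finrank ℂ H)) : 0 ≤ LinearMap.trace ℂ H (e.proj i ∘ₗ ρ.op) := by
  have hidem : e.proj i ∘ₗ e.proj i = e.proj i := by
    ext x
    exact (e.eigenspace i).starProjection_eq_self_iff.mpr
      ((e.eigenspace i).starProjection_apply_mem x)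
  have hsymm : (e.proj i).IsSymmetric := (e.eigenspace i).starProjection_isSymmetric
  have hpos : (e.proj i ∘ₗ ρ.op ∘ₗ e.proj i).IsPositive := by
    refine ⟨fun x y => ?_, fun x => ?_⟩
    · simp only [LinearMap.comp_apply]
      rw [hsymm, ρ.isPositive.1, hsymm]
    · simp only [LinearMap.comp_apply]
      rw [hsymm]
      exact ρ.isPositive.2 _
  have h := hpos.trace_nonneg
  rwa [← LinearMap.comp_assoc, LinearMap.trace_comp_comm', ← LinearMap.comp_assoc, hidem] at h

theorem sum_proj (e : Observable H) : ∑ i, e.proj i = LinearMap.id := by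
  have hinj : Function.Injective
      fun i : Fin (Module.finrank ℂ H) => ((i : ℕ) : ℂ) + 1 := by
    intro i j h
    simpa [Fin.ext_iff] using h
  have horth : OrthogonalFamily ℂ (fun i => e.eigenspace i)
      fun i => (e.eigenspace i).subtypeₗᵢ :=
    e.isSymmetric.orthogonalFamily_eigenspaces.comp hinj
  have htop : ⨆ i, e.eigenspace i = ⊤ := by
    have h := e.isSymmetric.orthogonalComplement_iSup_eigenspaces_eq_bot
    rw [Submodule.orthogonal_eq_bot_iff] at h
    rw [eq_top_iff, ← h]
    refine iSup_le fun μ => ?_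
    by_cases hμ : Module.End.HasEigenvalue e.op μ
    · have hm := hμ.mem_spectrum
      rw [e.spectrum_eq] at hm
      obtain ⟨i, rfl⟩ := hm
      exact le_iSup e.eigenspace i
    · have : Module.End.eigenspace e.op μ = ⊥ := by
        simpa [Module.End.hasEigenvalue_iff] using hμ
      simp [this]
  ext x
  have := horth.sum_projection_of_mem_iSup x (htop ▸ Submodule.mem_top)
  simpa [proj] using this

/-- The outcome probabilities of a measurement form a classical state. -/
theorem pr_mem (ρ : QuantumState H) (e : Observable H) :
    pr ρ e ∈ stdSimplex ℝ (Fin (Module.finrank ℂ H)) := by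
  refine ⟨fun i => ?_, ?_⟩
  · exact (Complex.nonneg_iff.mp (trace_proj_comp_nonneg ρ e i)).1
  · have h : ∑ i, LinearMap.trace ℂ H (e.proj i ∘ₗ ρ.op) = 1 := by
      have hs : ∑ i, e.proj i ∘ₗ ρ.op = (∑ i, e.proj i) ∘ₗ ρ.op := by
        ext x
        simp
      rw [← map_sum, hs, sum_proj, LinearMap.id_comp, ρ.trace_eq_one]
    simpa [pr] using congrArg Complex.re h

/-- `spec(ρ|e)`: the classical state of the outcome probabilities when `e` is measured in the
state `ρ`. -/
def spec (ρ : QuantumState H) (e : Observable H) : ClassicalState (Module.finrank ℂ H) where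
  prob := pr ρ e
  mem_simplex := pr_mem ρ e

end Observable

/-- Quantum states carry the spectral order: `ρ ⊑ σ` iff some observable `e` with spectrum
`{1, …, n}` commutes with both and `spec(ρ|e) ⊑ spec(σ|e)` in the Bayesian order. -/
instance : LE (QuantumState H) :=
  ⟨fun ρ σ => ∃ e : Observable H, Commute ρ.op e.op ∧ Commute σ.op e.op ∧
    Observable.spec ρ e ≤ Observable.spec σ e⟩

end StateDomains

end

/-!
For each nonempty set `S` of outcomes there is the uniform distribution `unif S`, and for each
state `x` the set `top x` of its most likely outcomes. A state `x` lies below `unif S` exactly if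
`S ⊆ top x` (`ClassicalState.le_unif_iff`), and `top (unif S) = S`. Hence the maximal elements are
the uniform distributions on single outcomes (the pure states), the maximal elements above `x` are
the pure states of the outcomes in `top x`, and their greatest lower bound is `unif (top x)`. So the
irreducible elements are the uniform distributions, and `unif S ≤ unif T` means `T ⊆ S`. Only one
case of antisymmetry is needed: `unif (top x) ≤ x` implies `x = unif (top x)`, because larger states
have smaller support.

This argument uses nothing but a handful of properties of `unif` and `top`, which are collected in
`UniformSystem`; its conclusion is `UniformSystem.irIso`. For the Bayesian order, these properties
come from three facts proved by induction along the Bayesian projections: the order is coherent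
(`ClassicalState.prob_le_of_le`), larger states have smaller support
(`ClassicalState.prob_eq_zero_of_le`), and a distribution that is constant on its support lies above
every state that is largest there (`ClassicalState.le_of_forall_support`).

For quantum states, `unif K` is the normalized projection onto the subspace `K`, and `top ρ` is the
eigenspace of `ρ` for its largest eigenvalue. The spectral order is the Bayesian order in a common
orthonormal eigenbasis (`QuantumState.le_iff_exists_diag`), in which `unif` and `top` become their
classical counterparts, so the properties reduce to the classical ones. The reduction needs an
eigenbasis of `ρ` that is adapted to a given subspace of `top ρ` (`QuantumState.exists_adapted`).
-/

noncomputable section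

namespace StateDomains

open Module

/-! ### Orders with uniform elements -/

/-- Uniform elements `u K` of `D`, indexed by the nonzero elements `K` of `L`, together with a map
`t` assigning to each `x : D` the part of `L` on which `x` is largest. Neither transitivity nor
full antisymmetry of the relation on `D` is assumed. -/
structure UniformSystem (D L : Type*) [LE D] [PartialOrder L] [OrderBot L] where
  /-- The uniform element supported by `K`. -/
  u : {K : L // K ≠ ⊥} → D
  /-- The part on which `x` is largest. -/
  t : D → {K : L // K ≠ ⊥}
  /-- The two maps form an antitone Galois connection. -/
  le_u_iff : ∀ x K, x ≤ u K ↔ K ≤ t x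
  t_u : ∀ K, t (u K) = K
  t_le_of_u_le : ∀ K x, u K ≤ x → t x ≤ K
  /-- The only instance of antisymmetry that matters for irreducible elements. -/
  eq_u_of_u_le : ∀ x, u (t x) ≤ x → x = u (t x)

namespace UniformSystem

variable {D L : Type*} [LE D] [PartialOrder L] [OrderBot L] (U : UniformSystem D L)

theorem u_le_u_iff (K M : {K : L // K ≠ ⊥}) : U.u K ≤ U.u M ↔ M ≤ K := by
  rw [U.le_u_iff, U.t_u]

variable [IsAtomistic L]

theorem mem_maxElements_iff (x : D) :
    x ∈ maxElements D ↔ ∃ A : {K : L // K ≠ ⊥}, IsAtom A.1 ∧ x = U.u A := by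
  constructor
  · intro hx
    obtain ⟨A, hA, hAx⟩ := (eq_bot_or_exists_atom_le (U.t x).1).resolve_left (U.t x).2
    refine ⟨⟨A, hA.1⟩, hA, ?_⟩
    have h : U.u ⟨A, hA.1⟩ ∈ {y | x ≤ y} := (U.le_u_iff _ _).2 hAx
    rw [show {y | x ≤ y} = {x} from hx] at h
    exact h.symm
  · rintro ⟨A, hA, rfl⟩
    refine Set.Subset.antisymm (fun y (hy : U.u A ≤ y) => ?_) ?_
    · have hle : (U.t y).1 ≤ A.1 := U.t_le_of_u_le A y hy
      have hAy : U.t y = A := Subtype.ext ((hA.le_iff.1 hle).resolve_left (U.t y).2)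
      have := U.eq_u_of_u_le y (by rwa [hAy])
      rw [hAy] at this
      exact this
    · rintro _ rfl
      exact (U.u_le_u_iff A A).2 le_rfl

theorem isGLB_u (x : D) : IsGLB ({y | x ≤ y} ∩ maxElements D) (U.u (U.t x)) := by
  constructor
  · rintro y ⟨hxy : x ≤ y, hy⟩
    obtain ⟨A, -, rfl⟩ := (U.mem_maxElements_iff y).1 hy
    exact (U.u_le_u_iff _ _).2 ((U.le_u_iff _ _).1 hxy)
  · intro z hz
    rw [U.le_u_iff, ← Subtype.coe_le_coe, le_iff_atom_le_imp]
    intro A hA hAx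
    have h : U.u ⟨A, hA.1⟩ ∈ {y | x ≤ y} ∩ maxElements D :=
      ⟨(U.le_u_iff _ _).2 hAx, (U.mem_maxElements_iff _).2 ⟨_, hA, rfl⟩⟩
    exact (U.le_u_iff _ _).1 (hz h)

/-- The irreducible elements are exactly the uniform ones. -/
theorem mem_Ir_iff (x : D) : x ∈ Ir D ↔ x = U.u (U.t x) := by
  constructor
  · intro hx
    exact U.eq_u_of_u_le x (hx.2 (U.isGLB_u x).1)
  · intro hx
    have := U.isGLB_u x
    rwa [← hx] at this

/-- Irreducible elements, with the order reversed, are the nonzero elements of `L`. -/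
def irIso : (Ir D)ᵒᵈ ≃o {K : L // K ≠ ⊥} where
  toFun x := U.t (OrderDual.ofDual x).1
  invFun K := OrderDual.toDual ⟨U.u K, (U.mem_Ir_iff _).2 (by rw [U.t_u])⟩
  left_inv x := Subtype.ext ((U.mem_Ir_iff _).1 (OrderDual.ofDual x).2).symm
  right_inv K := U.t_u K
  map_rel_iff' {x y} := by
    obtain ⟨x, hx⟩ := x
    obtain ⟨y, hy⟩ := y
    change U.t x ≤ U.t y ↔ y ≤ x
    rw [(U.mem_Ir_iff x).1 hx, (U.mem_Ir_iff y).1 hy, U.u_le_u_iff, U.t_u, U.t_u]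

end UniformSystem

/-! ### Classical states -/

namespace ClassicalState

theorem nonneg {n : ℕ} (x : ClassicalState n) (i : Fin n) : 0 ≤ x.prob i := x.mem_simplex.1 i

theorem sum_eq_one {n : ℕ} (x : ClassicalState n) : ∑ i, x.prob i = 1 := x.mem_simplex.2

theorem eq_zero_of_eq_one {n : ℕ} {x : ClassicalState n} {i j : Fin n} (hi : x.prob i = 1)
    (hij : j ≠ i) : x.prob j = 0 := by
  have h := Finset.add_le_sum (fun k _ => x.nonneg k) (Finset.mem_univ i) (Finset.mem_univ j)
    hij.symm
  rw [x.sum_eq_one] at h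
  linarith [x.nonneg j]

theorem prob_le_one {n : ℕ} (x : ClassicalState n) (i : Fin n) : x.prob i ≤ 1 :=
  x.sum_eq_one ▸ Finset.single_le_sum (fun k _ => x.nonneg k) (Finset.mem_univ i)

theorem one_sub_pos {n : ℕ} {x : ClassicalState n} {i : Fin n} (hi : x.prob i ≠ 1) :
    0 < 1 - x.prob i :=
  sub_pos.2 (lt_of_le_of_ne (x.prob_le_one i) hi)

theorem exists_pos {n : ℕ} (x : ClassicalState n) : ∃ i, 0 < x.prob i := by
  obtain ⟨i, -, hi⟩ := Finset.exists_lt_of_sum_lt (s := Finset.univ) (f := fun _ => (0 : ℝ))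
    (g := x.prob) (by simp [x.sum_eq_one])
  exact ⟨i, hi⟩

theorem prob_one_eq (x : ClassicalState 2) : x.prob 1 = 1 - x.prob 0 := by
  have := x.sum_eq_one
  rw [Fin.sum_univ_two] at this
  linarith

theorem le_two_iff (x y : ClassicalState 2) : x ≤ y ↔
    (y.prob 0 ≤ x.prob 0 ∧ x.prob 0 ≤ 1 / 2) ∨ (1 / 2 ≤ x.prob 0 ∧ x.prob 0 ≤ y.prob 0) :=
  Iff.rfl

theorem le_add_three_iff {n : ℕ} (x y : ClassicalState (n + 3)) : x ≤ y ↔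
    ∀ (i : Fin (n + 3)) (hx : x.prob i ≠ 1) (hy : y.prob i ≠ 1),
      bayesianProj i x hx ≤ bayesianProj i y hy :=
  Iff.rfl

@[simp]
theorem bayesianProj_prob {n : ℕ} (i : Fin (n + 1)) (x : ClassicalState (n + 1))
    (hx : x.prob i ≠ 1) (j : Fin n) :
    (bayesianProj i x hx).prob j = x.prob (i.succAbove j) / (1 - x.prob i) := rfl

/-- The order is coherent: a nonzero outcome of `y` that is at least as likely as another one is so
in every `x ⊑ y`. -/
theorem prob_le_of_le {n : ℕ} {x y : ClassicalState (n + 2)} (hxy : x ≤ y) {i j : Fin (n + 2)}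
    (hi : 0 < y.prob i) (hji : y.prob j ≤ y.prob i) : x.prob j ≤ x.prob i := by
  induction n with
  | zero =>
    rw [le_two_iff] at hxy
    have hx := x.prob_one_eq
    have hy := y.prob_one_eq
    fin_cases i <;> fin_cases j <;> simp at * <;> rcases hxy with h | h <;> linarith
  | succ n ih =>
    rw [le_add_three_iff] at hxy
    rcases eq_or_ne j i with rfl | hne
    · exact le_rfl
    obtain ⟨k, hki, hkj⟩ : ∃ k : Fin (n + 3), k ≠ i ∧ k ≠ j := by
      obtain ⟨k, hk⟩ := Finset.exists_mem_notMem_of_card_lt_card (s := {i, j})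
        (t := (Finset.univ : Finset (Fin (n + 3))))
        (lt_of_le_of_lt Finset.card_le_two (by simp))
      exact ⟨k, by simpa using hk⟩
    by_cases hyk : y.prob k = 1
    · exact absurd (eq_zero_of_eq_one hyk hki.symm) hi.ne'
    by_cases hxk : x.prob k = 1
    · rw [eq_zero_of_eq_one hxk hki.symm, eq_zero_of_eq_one hxk hkj.symm]
    obtain ⟨i, rfl⟩ := Fin.exists_succAbove_eq hki.symm
    obtain ⟨j, rfl⟩ := Fin.exists_succAbove_eq hkj.symm
    have hyp := one_sub_pos hyk
    have hxp := one_sub_pos hxk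
    have := ih (hxy k hxk hyk) (i := i) (j := j) (by simpa using div_pos hi hyp)
      (by simpa using div_le_div_of_nonneg_right hji hyp.le)
    simpa [div_le_div_iff_of_pos_right hxp] using this

/-- Larger states have smaller support. -/
theorem prob_eq_zero_of_le {n : ℕ} {x y : ClassicalState (n + 2)} (hxy : x ≤ y) {j : Fin (n + 2)}
    (hj : x.prob j = 0) : y.prob j = 0 := by
  induction n with
  | zero =>
    rw [le_two_iff] at hxy
    have hx := x.prob_one_eq
    have hy := y.prob_one_eq
    have h0 := y.nonneg 0
    have h1 := y.nonneg 1
    fin_cases j <;> simp at * <;> rcases hxy with h | h <;> linarith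
  | succ n ih =>
    rw [le_add_three_iff] at hxy
    -- At most one of the entries other than the `j`-th is equal to one.
    obtain ⟨k, hkj, hxk⟩ : ∃ k : Fin (n + 3), k ≠ j ∧ x.prob k ≠ 1 := by
      obtain ⟨l, hl⟩ : ∃ l, l ≠ j := exists_ne j
      obtain ⟨k, hk⟩ := Finset.exists_mem_notMem_of_card_lt_card (s := {l, j})
        (t := (Finset.univ : Finset (Fin (n + 3))))
        (lt_of_le_of_lt Finset.card_le_two (by simp))
      have hk : k ≠ l ∧ k ≠ j := by simpa using hk
      by_cases h : x.prob l = 1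
      · exact ⟨k, hk.2, by simp [eq_zero_of_eq_one h hk.1]⟩
      · exact ⟨l, hl, h⟩
    by_cases hyk : y.prob k = 1
    · exact eq_zero_of_eq_one hyk hkj.symm
    obtain ⟨j, rfl⟩ := Fin.exists_succAbove_eq hkj.symm
    have := ih (hxy k hxk hyk) (j := j) (by simp [hj])
    simpa [(one_sub_pos hyk).ne'] using this

/-- A state `y` that is constant on its support lies above every state that is largest there. -/
theorem le_of_forall_support {n : ℕ} {x y : ClassicalState (n + 2)}
    (hx : ∀ i j, y.prob i ≠ 0 → x.prob j ≤ x.prob i)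
    (hy : ∀ i j, y.prob i ≠ 0 → y.prob j ≠ 0 → y.prob i = y.prob j) : x ≤ y := by
  induction n with
  | zero =>
    rw [le_two_iff]
    have hx1 := x.prob_one_eq
    have hy1 := y.prob_one_eq
    have h00 := x.nonneg 0
    have h11 := x.nonneg 1
    by_cases h0 : y.prob 0 = 0
    · have := hx 1 0 (by rw [hy1, h0]; norm_num)
      exact Or.inl ⟨by linarith, by linarith⟩
    · have h2 := hx 0 1 h0
      by_cases h1 : y.prob 1 = 0
      · exact Or.inr ⟨by linarith, by linarith⟩
      · have h3 := hx 1 0 h1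
        have h4 := hy 0 1 h0 h1
        exact Or.inl ⟨by linarith, by linarith⟩
  | succ n ih =>
    rw [le_add_three_iff]
    intro k hxk hyk
    have hyp := one_sub_pos hyk
    have hxp := one_sub_pos hxk
    refine ih (fun i j hi => ?_) (fun i j hi hj => ?_)
    · have hi : y.prob (k.succAbove i) ≠ 0 := fun h => hi (by simp [h])
      simpa using div_le_div_of_nonneg_right (hx _ (k.succAbove j) hi) hxp.le
    · have hi : y.prob (k.succAbove i) ≠ 0 := fun h => hi (by simp [h])
      have hj : y.prob (k.succAbove j) ≠ 0 := fun h => hj (by simp [h])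
      simp [hy _ _ hi hj]

/-- The outcomes of largest probability. -/
def top {n : ℕ} (x : ClassicalState n) : Set (Fin n) := {i | ∀ j, x.prob j ≤ x.prob i}

theorem top_nonempty {n : ℕ} (x : ClassicalState n) : x.top.Nonempty := by
  obtain ⟨i, -⟩ := x.exists_pos
  have : Nonempty (Fin n) := ⟨i⟩
  obtain ⟨k, hk⟩ := Finite.exists_max x.prob
  exact ⟨k, hk⟩

theorem pos_of_mem_top {n : ℕ} {x : ClassicalState n} {i : Fin n} (hi : i ∈ x.top) :
    0 < x.prob i := by
  obtain ⟨j, hj⟩ := x.exists_pos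
  exact hj.trans_le (hi j)

open Classical in
/-- The uniform distribution on a nonempty set of outcomes. -/
def unif {n : ℕ} (S : Set (Fin n)) (hS : S.Nonempty) : ClassicalState n where
  prob i := if i ∈ S then (S.ncard : ℝ)⁻¹ else 0
  mem_simplex := by
    refine ⟨fun i => by positivity, ?_⟩
    have h : (S.ncard : ℝ) ≠ 0 := by
      exact_mod_cast ((Set.ncard_pos S.toFinite).2 hS).ne'
    have hc : S.ncard = (Finset.univ.filter (· ∈ S)).card := by
      rw [← Set.ncard_coe_finset]; simp
    rw [← Finset.sum_filter, Finset.sum_const, ← hc, nsmul_eq_mul, mul_inv_cancel₀ h]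

theorem unif_prob_ne_zero {n : ℕ} {S : Set (Fin n)} {hS : S.Nonempty} {i : Fin n} :
    (unif S hS).prob i ≠ 0 ↔ i ∈ S := by
  have h : S.ncard ≠ 0 := ((Set.ncard_pos S.toFinite).2 hS).ne'
  simp [unif, h]

theorem unif_prob_of_mem {n : ℕ} {S : Set (Fin n)} {hS : S.Nonempty} {i : Fin n} (hi : i ∈ S) :
    (unif S hS).prob i = (S.ncard : ℝ)⁻¹ := if_pos hi

theorem unif_prob_of_notMem {n : ℕ} {S : Set (Fin n)} {hS : S.Nonempty} {i : Fin n} (hi : i ∉ S) :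
    (unif S hS).prob i = 0 := if_neg hi

theorem unif_congr {n : ℕ} {S T : Set (Fin n)} (h : S = T) (hS : S.Nonempty) (hT : T.Nonempty) :
    unif S hS = unif T hT := by
  subst h; rfl

@[simp]
theorem top_unif {n : ℕ} (S : Set (Fin n)) (hS : S.Nonempty) : (unif S hS).top = S := by
  ext i
  constructor
  · intro hi
    exact unif_prob_ne_zero.1 (pos_of_mem_top hi).ne'
  · intro hi j
    by_cases hj : j ∈ S
    · rw [unif_prob_of_mem hi, unif_prob_of_mem hj]
    · rw [unif_prob_of_notMem hj]
      exact nonneg _ i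

theorem eq_unif {n : ℕ} {x : ClassicalState n} (h : ∀ i, i ∉ x.top → x.prob i = 0) :
    x = unif x.top x.top_nonempty := by
  have hc : ∀ i ∈ x.top, x.prob i = (x.top.ncard : ℝ)⁻¹ := by
    classical
    intro k hk
    have hcard : x.top.ncard = (Finset.univ.filter (· ∈ x.top)).card := by
      rw [← Set.ncard_coe_finset]; simp
    have hsum := x.sum_eq_one
    rw [← Finset.sum_filter_add_sum_filter_not Finset.univ (· ∈ x.top),
      Finset.sum_congr rfl fun i hi => le_antisymm (hk i) ((by simpa using hi : i ∈ x.top) k),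
      Finset.sum_eq_zero fun i hi => h i (by simpa using hi), add_zero, Finset.sum_const,
      ← hcard, nsmul_eq_mul] at hsum
    exact eq_inv_of_mul_eq_one_right hsum
  ext i
  by_cases hi : i ∈ x.top
  · rw [unif_prob_of_mem hi, hc i hi]
  · rw [unif_prob_of_notMem hi, h i hi]

theorem le_unif_iff {n : ℕ} (hn : 2 ≤ n) (x : ClassicalState n) (S : Set (Fin n))
    (hS : S.Nonempty) : x ≤ unif S hS ↔ S ⊆ x.top := by
  obtain ⟨n, rfl⟩ := Nat.exists_eq_add_of_le' hn
  constructor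
  · intro h i hi j
    have ht : i ∈ (unif S hS).top := by simpa using hi
    exact prob_le_of_le h (pos_of_mem_top ht) (ht j)
  · intro h
    refine le_of_forall_support (fun i j hi => h (unif_prob_ne_zero.1 hi) j) fun i j hi hj => ?_
    rw [unif_prob_of_mem (unif_prob_ne_zero.1 hi), unif_prob_of_mem (unif_prob_ne_zero.1 hj)]

theorem prob_eq_zero_of_unif_le {n : ℕ} (hn : 2 ≤ n) {x : ClassicalState n} {S : Set (Fin n)}
    {hS : S.Nonempty} (h : unif S hS ≤ x) {i : Fin n} (hi : i ∉ S) : x.prob i = 0 := by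
  obtain ⟨n, rfl⟩ := Nat.exists_eq_add_of_le' hn
  exact prob_eq_zero_of_le h (unif_prob_of_notMem hi)

theorem top_subset_of_unif_le {n : ℕ} (hn : 2 ≤ n) {x : ClassicalState n} {S : Set (Fin n)}
    {hS : S.Nonempty} (h : unif S hS ≤ x) : x.top ⊆ S := fun i hi => by
  by_contra hiS
  exact (pos_of_mem_top hi).ne' (prob_eq_zero_of_unif_le hn h hiS)

/-- The uniform distributions form a uniform system indexed by the nonempty sets of outcomes. -/
def uniformSystem {n : ℕ} (hn : 2 ≤ n) : UniformSystem (ClassicalState n) (Set (Fin n)) where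
  u S := unif S.1 (Set.nonempty_iff_ne_empty.2 S.2)
  t x := ⟨x.top, x.top_nonempty.ne_empty⟩
  le_u_iff x S := le_unif_iff hn x S.1 _
  t_u _ := Subtype.ext (top_unif _ _)
  t_le_of_u_le _ _ h := top_subset_of_unif_le hn h
  eq_u_of_u_le _ h := eq_unif fun _ hi => prob_eq_zero_of_unif_le hn h hi

end ClassicalState

variable {H : Type*} [NormedAddCommGroup H] [InnerProductSpace ℂ H]
open Module

/-! ### Operators that are diagonal in an orthonormal basis -/

section Diagonal

variable {ι : Type*} [Fintype ι] (b : OrthonormalBasis ι ℂ H)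

/-- The operator that is diagonal in the orthonormal basis `b`, with real diagonal entries `c`. -/
def diagOp (c : ι → ℝ) : H →ₗ[ℂ] H := b.toBasis.constr ℂ fun i => (c i : ℂ) • b i

theorem diagOp_basis (c : ι → ℝ) (i : ι) : diagOp b c (b i) = (c i : ℂ) • b i := by
  have h := b.toBasis.constr_basis ℂ (fun i => (c i : ℂ) • b i) i
  rwa [b.coe_toBasis] at h

theorem inner_basis_ext {v w : H} (h : ∀ i, inner ℂ (b i) v = inner ℂ (b i) w) : v = w := by
  rw [← b.sum_repr' v, ← b.sum_repr' w]
  simp [h]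

theorem inner_basis_diagOp (c : ι → ℝ) (i : ι) (v : H) :
    inner ℂ (b i) (diagOp b c v) = c i * inner ℂ (b i) v := by
  classical
  conv_lhs => rw [← b.sum_repr' v]
  simp only [map_sum, map_smul, diagOp_basis, inner_sum, inner_smul_right, b.inner_eq_ite]
  simp [mul_comm]

theorem isSymmetric_diagOp (c : ι → ℝ) : (diagOp b c).IsSymmetric := by
  intro v w
  rw [← b.sum_inner_mul_inner, ← b.sum_inner_mul_inner v]
  refine Finset.sum_congr rfl fun i _ => ?_
  rw [inner_basis_diagOp, ← inner_conj_symm, inner_basis_diagOp, map_mul, Complex.conj_ofReal,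
    inner_conj_symm]
  ring

theorem isPositive_diagOp {c : ι → ℝ} (hc : ∀ i, 0 ≤ c i) : (diagOp b c).IsPositive := by
  refine ⟨isSymmetric_diagOp b c, fun v => ?_⟩
  rw [isSymmetric_diagOp b c, ← b.sum_inner_mul_inner, map_sum]
  refine Finset.sum_nonneg fun i _ => ?_
  rw [inner_basis_diagOp, mul_left_comm, ← inner_conj_symm, ← Complex.normSq_eq_conj_mul_self,
    ← Complex.ofReal_mul]
  exact mul_nonneg (hc i) (Complex.normSq_nonneg _)

theorem trace_diagOp (c : ι → ℝ) : LinearMap.trace ℂ H (diagOp b c) = ((∑ i, c i : ℝ) : ℂ) := by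
  rw [LinearMap.trace_eq_sum_inner _ b]
  simp only [diagOp_basis, inner_smul_right]
  simp

theorem mem_eigenspace_diagOp (c : ι → ℝ) (μ : ℂ) (v : H) :
    v ∈ End.eigenspace (diagOp b c) μ ↔ ∀ i, (c i : ℂ) ≠ μ → inner ℂ (b i) v = 0 := by
  rw [End.mem_eigenspace_iff]
  constructor
  · intro h i hi
    have := congrArg (inner ℂ (b i)) h
    rw [inner_basis_diagOp, inner_smul_right] at this
    have h2 : ((c i : ℂ) - μ) * inner ℂ (b i) v = 0 := by linear_combination this
    exact (mul_eq_zero.1 h2).resolve_left (sub_ne_zero.2 hi)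
  · intro h
    refine inner_basis_ext b fun i => ?_
    rw [inner_basis_diagOp, inner_smul_right]
    by_cases hi : (c i : ℂ) = μ
    · rw [hi]
    · simp [h i hi]

theorem hasEigenvalue_diagOp_iff (c : ι → ℝ) (μ : ℂ) :
    End.HasEigenvalue (diagOp b c) μ ↔ ∃ i, (c i : ℂ) = μ := by
  constructor
  · intro h
    obtain ⟨v, hv⟩ := h.exists_hasEigenvector
    by_contra! hne
    exact hv.2 (inner_basis_ext b fun i => by
      rw [(mem_eigenspace_diagOp b c μ v).1 hv.1 i (hne i), inner_zero_right])
  · rintro ⟨i, rfl⟩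
    exact End.hasEigenvalue_of_hasEigenvector (x := b i)
      ⟨End.mem_eigenspace_iff.2 (diagOp_basis b c i), b.orthonormal.ne_zero i⟩

theorem commute_diagOp (c d : ι → ℝ) : Commute (diagOp b c) (diagOp b d) := by
  refine b.toBasis.ext fun i => ?_
  simp only [b.coe_toBasis, Module.End.mul_apply, diagOp_basis, map_smul]
  exact smul_comm _ _ _

/-- The subspace spanned by part of an orthonormal basis. -/
def basisSpan (S : Set ι) : Submodule ℂ H := Submodule.span ℂ (b '' S)

theorem mem_basisSpan {S : Set ι} {v : H} :
    v ∈ basisSpan b S ↔ ∀ i, i ∉ S → inner ℂ (b i) v = 0 := by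
  have h := b.toBasis.mem_span_image (m := v) (s := S)
  rw [b.coe_toBasis] at h
  rw [basisSpan, h]
  constructor
  · intro h i hi
    by_contra hne
    exact hi (h (by simpa [b.repr_apply_apply] using hne))
  · intro h i hi
    by_contra hne
    have := h i hne
    simp [b.repr_apply_apply, this] at hi

theorem basis_mem_basisSpan {S : Set ι} {i : ι} : b i ∈ basisSpan b S ↔ i ∈ S := by
  refine ⟨fun h => ?_, fun h => Submodule.subset_span ⟨i, h, rfl⟩⟩
  by_contra hi
  simpa using (mem_basisSpan b).1 h i hi

theorem basisSpan_le_basisSpan {S T : Set ι} : basisSpan b S ≤ basisSpan b T ↔ S ⊆ T :=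
  ⟨fun h _ hi => (basis_mem_basisSpan b).1 (h ((basis_mem_basisSpan b).2 hi)),
    fun h => Submodule.span_mono (Set.image_mono h)⟩

theorem basisSpan_injective : Function.Injective (basisSpan b) := fun _ _ h =>
  Set.Subset.antisymm ((basisSpan_le_basisSpan b).1 h.le) ((basisSpan_le_basisSpan b).1 h.ge)

theorem basisSpan_ne_bot {S : Set ι} : basisSpan b S ≠ ⊥ ↔ S.Nonempty := by
  have : basisSpan b ∅ = ⊥ := by simp [basisSpan]
  rw [← this, (basisSpan_injective b).ne_iff, Set.nonempty_iff_ne_empty]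

theorem finrank_basisSpan (S : Set ι) : finrank ℂ (basisSpan b S) = S.ncard := by
  classical
  have hinj : Function.Injective b := b.orthonormal.linearIndependent.injective
  have h := finrank_span_set_eq_card (R := ℂ) (s := b '' S)
    (b.orthonormal.linearIndependent.linearIndepOn S).id_image
  rw [basisSpan, h, ← Set.ncard_eq_toFinset_card', Set.ncard_image_of_injective S hinj]

/-- A subspace is spanned by the members of an orthonormal basis in it, if the other members are
orthogonal to it. -/
theorem eq_basisSpan {K : Submodule ℂ H} (h : ∀ i, b i ∈ K ∨ b i ∈ Kᗮ) :
    K = basisSpan b {i | b i ∈ K} := by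
  refine le_antisymm (fun v hv => (mem_basisSpan b).2 fun i hi => ?_) ?_
  · exact Submodule.inner_left_of_mem_orthogonal hv ((h i).resolve_left hi)
  · rw [basisSpan, Submodule.span_le]
    rintro _ ⟨i, hi, rfl⟩
    exact hi

theorem starProjection_basisSpan [FiniteDimensional ℂ H] (S : Set ι) [DecidablePred (· ∈ S)] (i : ι) :
    (basisSpan b S).starProjection (b i) = if i ∈ S then b i else 0 := by
  split_ifs with hi
  · exact Submodule.starProjection_eq_self_iff.2 ((basis_mem_basisSpan b).2 hi)
  · rw [Submodule.starProjection_apply_eq_zero_iff, Submodule.mem_orthogonal']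
    exact fun v hv => (mem_basisSpan b).1 hv i hi

end Diagonal

variable [FiniteDimensional ℂ H]

/-! ### Quantum states in an eigenbasis -/

namespace QuantumState

variable (b : OrthonormalBasis (Fin (finrank ℂ H)) ℂ H)

/-- The quantum state that is diagonal in an orthonormal basis, with the probabilities of a
classical state on the diagonal. -/
def diag (x : ClassicalState (finrank ℂ H)) : QuantumState H where
  op := diagOp b x.prob
  isPositive := isPositive_diagOp b x.nonneg
  trace_eq_one := by rw [trace_diagOp, x.sum_eq_one, Complex.ofReal_one]

theorem diag_injective : Function.Injective (diag b) := by
  intro x y h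
  ext i
  have h2 : diagOp b x.prob (b i) = diagOp b y.prob (b i) := by
    rw [show diagOp b x.prob = diagOp b y.prob from congrArg op h]
  rw [diagOp_basis, diagOp_basis] at h2
  exact Complex.ofReal_injective (smul_left_injective ℂ (b.orthonormal.ne_zero i) h2)

/-- A quantum state with an orthonormal basis of eigenvectors is diagonal in that basis. -/
theorem exists_eq_diag {ρ : QuantumState H} (h : ∀ i, ∃ c : ℂ, ρ.op (b i) = c • b i) :
    ∃ x, ρ = diag b x := by
  have hre : ∀ i, ((inner ℂ (b i) (ρ.op (b i))).re : ℂ) = inner ℂ (b i) (ρ.op (b i)) := fun i =>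
    ρ.isPositive.1.coe_re_inner_self_apply (b i)
  refine ⟨⟨fun i => (inner ℂ (b i) (ρ.op (b i))).re, fun i => ?_, ?_⟩, ?_⟩
  · have := ρ.isPositive.2 (b i)
    rwa [ρ.isPositive.1] at this
  · rw [← Complex.re_sum, ← LinearMap.trace_eq_sum_inner, ρ.trace_eq_one, Complex.one_re]
  · refine QuantumState.ext (b.toBasis.ext fun i => ?_)
    obtain ⟨c, hc⟩ := h i
    have hd := diagOp_basis b (fun i => (inner ℂ (b i) (ρ.op (b i))).re) i
    rw [hre, hc, inner_smul_right, inner_self_eq_norm_sq_to_K, b.orthonormal.1] at hd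
    rw [b.coe_toBasis, hc]
    exact .symm (hd.trans (by simp))

end QuantumState

namespace Observable

variable (b : OrthonormalBasis (Fin (finrank ℂ H)) ℂ H)

/-- The observable with eigenvectors `b i` for the eigenvalues `i + 1`. -/
def ofBasis : Observable H where
  op := diagOp b fun i => ((i : ℕ) : ℝ) + 1
  isSymmetric := isSymmetric_diagOp b _
  spectrum_eq := by
    ext μ
    rw [← End.hasEigenvalue_iff_mem_spectrum, hasEigenvalue_diagOp_iff]
    simp

theorem mem_eigenspace_ofBasis (i : Fin (finrank ℂ H)) : b i ∈ (ofBasis b).eigenspace i := by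
  rw [eigenspace, End.mem_eigenspace_iff]
  exact (diagOp_basis b (fun i : Fin (finrank ℂ H) => ((i : ℕ) : ℝ) + 1) i).trans (by simp)

/-- Every observable has an orthonormal eigenbasis. -/
theorem exists_basis (e : Observable H) :
    ∃ b : OrthonormalBasis (Fin (finrank ℂ H)) ℂ H, ∀ i, b i ∈ e.eigenspace i := by
  have h : ∀ i, ∃ v ∈ e.eigenspace i, ‖v‖ = 1 := fun i => by
    have hi : End.HasEigenvalue e.op (((i : ℕ) : ℂ) + 1) := by
      rw [End.hasEigenvalue_iff_mem_spectrum, e.spectrum_eq]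
      exact ⟨i, rfl⟩
    obtain ⟨v, hv⟩ := hi.exists_hasEigenvector
    exact ⟨(‖v‖⁻¹ : ℂ) • v, Submodule.smul_mem _ _ hv.1, norm_smul_inv_norm hv.2⟩
  choose v hv hn using h
  have hinj : Function.Injective fun i : Fin (finrank ℂ H) => ((i : ℕ) : ℂ) + 1 := fun i j h => by
    simpa [Fin.ext_iff] using h
  have ho : Orthonormal ℂ v :=
    ⟨hn, fun i j hij => e.isSymmetric.orthogonalFamily_eigenspaces.comp hinj hij
      ⟨v i, hv i⟩ ⟨v j, hv j⟩⟩
  obtain ⟨b, hb⟩ := Orthonormal.exists_orthonormalBasis_extension_of_card_eq (s := Set.univ)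
    (v := v) (by simp) (ho.comp _ Subtype.val_injective)
  exact ⟨b, fun i => hb i trivial ▸ hv i⟩

variable {b} {e : Observable H}

theorem eigenspace_eq (hb : ∀ i, b i ∈ e.eigenspace i) (i : Fin (finrank ℂ H)) : e.eigenspace i = basisSpan b {i} := by
  have hop : e.op = diagOp b fun i => ((i : ℕ) : ℝ) + 1 := b.toBasis.ext fun i => by
    rw [b.coe_toBasis, diagOp_basis]
    simpa using End.mem_eigenspace_iff.1 (hb i)
  ext v
  rw [eigenspace, hop, mem_eigenspace_diagOp, mem_basisSpan]
  simp [Fin.ext_iff, ← Complex.ofReal_natCast]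

theorem spec_diag (hb : ∀ i, b i ∈ e.eigenspace i) (x : ClassicalState (finrank ℂ H)) :
    spec (QuantumState.diag b x) e = x := by
  classical
  ext i
  change (LinearMap.trace ℂ H (e.proj i ∘ₗ diagOp b x.prob)).re = x.prob i
  have h : e.proj i ∘ₗ diagOp b x.prob = diagOp b (Pi.single i (x.prob i)) :=
    b.toBasis.ext fun j => by
      simp only [b.coe_toBasis, LinearMap.comp_apply, diagOp_basis, map_smul, proj,
        ContinuousLinearMap.coe_coe, eigenspace_eq hb, starProjection_basisSpan]
      rcases eq_or_ne j i with rfl | hj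
      · simp
      · simp [hj]
  rw [h, trace_diagOp]
  simp

theorem exists_eq_diag_of_commute (hb : ∀ i, b i ∈ e.eigenspace i) {ρ : QuantumState H}
    (h : Commute ρ.op e.op) :
    ∃ x, ρ = QuantumState.diag b x := by
  refine QuantumState.exists_eq_diag b fun i => ?_
  have hm : ρ.op (b i) ∈ e.eigenspace i := by
    have hi := End.mem_eigenspace_iff.1 (hb i)
    rw [eigenspace, End.mem_eigenspace_iff, ← Module.End.mul_apply, ← h.eq, Module.End.mul_apply,
      hi, map_smul]
  rw [eigenspace_eq hb, basisSpan, Set.image_singleton, Submodule.mem_span_singleton] at hm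
  obtain ⟨c, hc⟩ := hm
  exact ⟨c, hc.symm⟩

end Observable

namespace QuantumState

/-- The spectral order is the Bayesian order in a common orthonormal eigenbasis. -/
theorem le_iff_exists_diag {ρ σ : QuantumState H} : ρ ≤ σ ↔
    ∃ (b : OrthonormalBasis (Fin (finrank ℂ H)) ℂ H) (x y : ClassicalState (finrank ℂ H)),
      ρ = diag b x ∧ σ = diag b y ∧ x ≤ y := by
  constructor
  · rintro ⟨e, hρ, hσ, hle⟩
    obtain ⟨b, hb⟩ := e.exists_basis
    obtain ⟨x, rfl⟩ := Observable.exists_eq_diag_of_commute hb hρ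
    obtain ⟨y, rfl⟩ := Observable.exists_eq_diag_of_commute hb hσ
    rw [Observable.spec_diag hb, Observable.spec_diag hb] at hle
    exact ⟨b, x, y, rfl, rfl, hle⟩
  · rintro ⟨b, x, y, rfl, rfl, hle⟩
    have hb := Observable.mem_eigenspace_ofBasis b
    refine ⟨Observable.ofBasis b, commute_diagOp b _ _, commute_diagOp b _ _, ?_⟩
    rwa [Observable.spec_diag hb, Observable.spec_diag hb]

theorem exists_diag (ρ : QuantumState H) :
    ∃ (b : OrthonormalBasis (Fin (finrank ℂ H)) ℂ H) (x : ClassicalState (finrank ℂ H)),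
      ρ = diag b x :=
  ⟨_, exists_eq_diag _ fun i => ⟨_, ρ.isPositive.1.apply_eigenvectorBasis rfl i⟩⟩

/-! ### The eigenspace for the largest eigenvalue -/

/-- The largest eigenvalue of a quantum state. -/
def maxEigenvalue (ρ : QuantumState H) : ℝ := sSup {μ : ℝ | End.HasEigenvalue ρ.op (μ : ℂ)}

/-- The eigenspace for the largest eigenvalue of a quantum state. -/
def top (ρ : QuantumState H) : Submodule ℂ H := End.eigenspace ρ.op (ρ.maxEigenvalue : ℂ)

theorem maxEigenvalue_diag (b : OrthonormalBasis (Fin (finrank ℂ H)) ℂ H)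
    {x : ClassicalState (finrank ℂ H)} {i : Fin (finrank ℂ H)} (hi : i ∈ x.top) :
    (diag b x).maxEigenvalue = x.prob i := by
  refine IsGreatest.csSup_eq ⟨(hasEigenvalue_diagOp_iff b _ _).2 ⟨i, rfl⟩, fun μ hμ => ?_⟩
  obtain ⟨j, hj⟩ := (hasEigenvalue_diagOp_iff b _ _).1 hμ
  exact Complex.ofReal_injective hj ▸ hi j

theorem le_maxEigenvalue {ρ : QuantumState H} {μ : ℝ} (h : End.HasEigenvalue ρ.op (μ : ℂ)) :
    μ ≤ ρ.maxEigenvalue := by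
  obtain ⟨b, x, rfl⟩ := ρ.exists_diag
  obtain ⟨i, hi⟩ := x.top_nonempty
  obtain ⟨j, hj⟩ := (hasEigenvalue_diagOp_iff b _ _).1 h
  rw [maxEigenvalue_diag b hi, ← Complex.ofReal_injective hj]
  exact hi j

theorem top_diag (b : OrthonormalBasis (Fin (finrank ℂ H)) ℂ H)
    (x : ClassicalState (finrank ℂ H)) : (diag b x).top = basisSpan b x.top := by
  obtain ⟨i, hi⟩ := x.top_nonempty
  ext v
  rw [top, maxEigenvalue_diag b hi, mem_basisSpan]
  refine (mem_eigenspace_diagOp b _ _ v).trans (forall_congr' fun j => imp_congr_left ?_)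
  rw [Ne, Complex.ofReal_inj, not_iff_not]
  exact ⟨fun h k => h ▸ hi k, fun h => le_antisymm (hi j) (h i)⟩

theorem top_ne_bot (ρ : QuantumState H) : ρ.top ≠ ⊥ := by
  obtain ⟨b, x, rfl⟩ := ρ.exists_diag
  rw [top_diag, basisSpan_ne_bot]
  exact x.top_nonempty

/-- A state has an eigenbasis adapted to each subspace `K` of its top eigenspace. It is an
eigenbasis of the sum of the state and the projection onto `K`: since the largest eigenvalue `m` is
taken on `K`, that sum has the eigenspace `K` for `m + 1`, and agrees with the state on `Kᗮ`. -/
theorem exists_adapted {ρ : QuantumState H} {K : Submodule ℂ H} (hK : K ≤ ρ.top) :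
    ∃ (b : OrthonormalBasis (Fin (finrank ℂ H)) ℂ H) (x : ClassicalState (finrank ℂ H))
      (S : Set (Fin (finrank ℂ H))), ρ = diag b x ∧ K = basisSpan b S := by
  set m := ρ.maxEigenvalue
  have hKm : ∀ k ∈ K, ρ.op k = (m : ℂ) • k := fun k hk => End.mem_eigenspace_iff.1 (hK hk)
  have hT : (ρ.op + K.starProjection.toLinearMap).IsSymmetric :=
    ρ.isPositive.1.add K.starProjection_isSymmetric
  set b := hT.eigenvectorBasis rfl
  have hb : ∀ i, (∃ c : ℂ, ρ.op (b i) = c • b i) ∧ (b i ∈ K ∨ b i ∈ Kᗮ) := by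
    intro i
    set μ := hT.eigenvalues rfl i
    have hv : ρ.op (b i) + K.starProjection (b i) = (μ : ℂ) • b i :=
      hT.apply_eigenvectorBasis rfl i
    set k := K.starProjection (b i)
    set w := b i - k with hw
    have hkK : k ∈ K := K.starProjection_apply_mem _
    have hwK : w ∈ Kᗮ := K.sub_starProjection_mem_orthogonal _
    have hzw : ρ.op w ∈ Kᗮ := fun u hu => by
      rw [← ρ.isPositive.1, hKm u hu, inner_smul_left, hwK u hu, mul_zero]
    have hbi : b i = k + w := by rw [hw]; abel
    have hsplit : ((m : ℂ) + 1 - μ) • k = (μ : ℂ) • w - ρ.op w := by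
      rw [hbi, map_add, hKm k hkK] at hv
      rw [sub_smul, add_smul, one_smul, sub_eq_sub_iff_add_eq_add, ← smul_add, add_comm w k,
        ← hv]
      abel
    have hzero : ((m : ℂ) + 1 - μ) • k = 0 :=
      Submodule.disjoint_def.1 K.orthogonal_disjoint _ (K.smul_mem _ hkK)
        (hsplit ▸ Kᗮ.sub_mem (Kᗮ.smul_mem _ hwK) hzw)
    have hwμ : ρ.op w = (μ : ℂ) • w := by
      rw [hzero] at hsplit
      exact (sub_eq_zero.1 hsplit.symm).symm
    by_cases hk0 : k = 0
    · rw [hbi, hk0, zero_add]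
      exact ⟨⟨μ, hwμ⟩, Or.inr hwK⟩
    · have hμm : m + 1 = μ := by
        have := sub_eq_zero.1 ((smul_eq_zero.1 hzero).resolve_right hk0)
        exact_mod_cast this
      have hw0 : w = 0 := by
        by_contra hw0
        have := le_maxEigenvalue (End.hasEigenvalue_of_hasEigenvector
          ⟨End.mem_eigenspace_iff.2 hwμ, hw0⟩)
        linarith
      rw [hbi, hw0, add_zero]
      exact ⟨⟨m, hKm k hkK⟩, Or.inl hkK⟩
  obtain ⟨x, hx⟩ := exists_eq_diag b fun i => (hb i).1
  exact ⟨b, x, _, hx, eq_basisSpan b fun i => (hb i).2⟩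

/-! ### Uniform quantum states -/

open scoped ComplexOrder in
/-- The uniform quantum state on a nonzero subspace `K`: the projection onto `K`, divided by the
dimension of `K`. -/
def unif (K : Submodule ℂ H) (hK : K ≠ ⊥) : QuantumState H where
  op := ((finrank ℂ K : ℝ)⁻¹ : ℂ) • K.starProjection.toLinearMap
  isPositive := by
    have h : K.starProjection.toLinearMap.IsPositive :=
      ⟨K.starProjection_isSymmetric, K.re_inner_starProjection_nonneg⟩
    refine h.smul_of_nonneg ?_
    rw [← Complex.ofReal_inv]
    exact Complex.zero_le_real.2 (by positivity)
  trace_eq_one := by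
    have h : LinearMap.IsProj K K.starProjection.toLinearMap :=
      ⟨fun v => K.starProjection_apply_mem v, fun v hv => K.starProjection_eq_self_iff.2 hv⟩
    have hn : finrank ℂ K ≠ 0 := fun h => hK (Submodule.finrank_eq_zero.1 h)
    rw [map_smul, h.trace]
    simp [hn]

theorem unif_congr {K M : Submodule ℂ H} (h : K = M) (hK : K ≠ ⊥) (hM : M ≠ ⊥) :
    unif K hK = unif M hM := by
  subst h; rfl

theorem unif_basisSpan (b : OrthonormalBasis (Fin (finrank ℂ H)) ℂ H)
    {S : Set (Fin (finrank ℂ H))} (hS : S.Nonempty) :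
    unif (basisSpan b S) ((basisSpan_ne_bot b).2 hS) = diag b (ClassicalState.unif S hS) := by
  classical
  refine QuantumState.ext (b.toBasis.ext fun i => ?_)
  simp only [unif, diag, b.coe_toBasis, diagOp_basis, LinearMap.smul_apply,
    ContinuousLinearMap.coe_coe, starProjection_basisSpan, finrank_basisSpan]
  by_cases hi : i ∈ S
  · rw [if_pos hi, ClassicalState.unif_prob_of_mem hi, Complex.ofReal_inv]
  · rw [if_neg hi, ClassicalState.unif_prob_of_notMem hi]
    simp

theorem exists_basisSpan (K : Submodule ℂ H) (hK : K ≠ ⊥) :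
    ∃ (b : OrthonormalBasis (Fin (finrank ℂ H)) ℂ H) (S : Set (Fin (finrank ℂ H))),
      S.Nonempty ∧ K = basisSpan b S := by
  have htop : (⊤ : Submodule ℂ H) ≠ ⊥ := fun h => hK (eq_bot_iff.2 (h ▸ le_top))
  have hK' : K ≤ (unif ⊤ htop).top := by
    have b := stdOrthonormalBasis ℂ H
    have hspan : (⊤ : Submodule ℂ H) = basisSpan b Set.univ := by
      refine (eq_top_iff.2 fun v _ => (mem_basisSpan b).2 fun i hi => ?_).symm
      exact absurd trivial hi
    have hne : (Set.univ : Set (Fin (finrank ℂ H))).Nonempty :=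
      (basisSpan_ne_bot b).1 (hspan ▸ htop)
    rw [unif_congr hspan htop ((basisSpan_ne_bot b).2 hne), unif_basisSpan b hne, top_diag,
      ClassicalState.top_unif, ← hspan]
    exact le_top
  obtain ⟨b, -, S, -, rfl⟩ := exists_adapted hK'
  exact ⟨b, S, (basisSpan_ne_bot b).1 hK, rfl⟩

@[simp]
theorem top_unif (K : Submodule ℂ H) (hK : K ≠ ⊥) : (unif K hK).top = K := by
  obtain ⟨b, S, hS, rfl⟩ := exists_basisSpan K hK
  rw [unif_basisSpan b hS, top_diag, ClassicalState.top_unif]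

/-- In every eigenbasis, a uniform quantum state is given by a uniform distribution. -/
theorem eq_unif_of_unif_eq_diag {K : Submodule ℂ H} {hK : K ≠ ⊥}
    {b : OrthonormalBasis (Fin (finrank ℂ H)) ℂ H} {x : ClassicalState (finrank ℂ H)}
    (h : unif K hK = diag b x) :
    x = ClassicalState.unif x.top x.top_nonempty ∧ K = basisSpan b x.top := by
  have hspan : K = basisSpan b x.top := by rw [← top_diag, ← h, top_unif]
  refine ⟨diag_injective b ?_, hspan⟩
  rw [← h, ← unif_basisSpan]
  exact unif_congr hspan _ _

theorem le_unif_iff (hn : 2 ≤ finrank ℂ H) (ρ : QuantumState H) (K : Submodule ℂ H) (hK : K ≠ ⊥) :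
    ρ ≤ unif K hK ↔ K ≤ ρ.top := by
  constructor
  · intro h
    obtain ⟨b, x, y, rfl, hy, hxy⟩ := le_iff_exists_diag.1 h
    obtain ⟨hyu, hspan⟩ := eq_unif_of_unif_eq_diag hy
    rw [hyu, ClassicalState.le_unif_iff hn] at hxy
    rw [hspan, top_diag, basisSpan_le_basisSpan]
    exact hxy
  · intro h
    obtain ⟨b, x, S, rfl, rfl⟩ := exists_adapted h
    have hS := (basisSpan_ne_bot b).1 hK
    rw [top_diag, basisSpan_le_basisSpan] at h
    exact le_iff_exists_diag.2
      ⟨b, x, _, rfl, unif_basisSpan b hS, (ClassicalState.le_unif_iff hn x S hS).2 h⟩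

theorem top_le_of_unif_le (hn : 2 ≤ finrank ℂ H) {ρ : QuantumState H} {K : Submodule ℂ H} {hK : K ≠ ⊥}
    (h : unif K hK ≤ ρ) : ρ.top ≤ K := by
  obtain ⟨b, x, y, hx, rfl, hxy⟩ := le_iff_exists_diag.1 h
  obtain ⟨hxu, hspan⟩ := eq_unif_of_unif_eq_diag hx
  rw [hxu] at hxy
  rw [hspan, top_diag, basisSpan_le_basisSpan]
  exact ClassicalState.top_subset_of_unif_le hn hxy

theorem eq_unif_of_unif_top_le (hn : 2 ≤ finrank ℂ H) {ρ : QuantumState H}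
    (h : unif ρ.top ρ.top_ne_bot ≤ ρ) :
    ρ = unif ρ.top ρ.top_ne_bot := by
  obtain ⟨b, x, y, hx, hy, hxy⟩ := le_iff_exists_diag.1 h
  obtain ⟨hxu, hspan⟩ := eq_unif_of_unif_eq_diag hx
  have htop : x.top = y.top := basisSpan_injective b (by rw [← hspan, hy, top_diag])
  rw [hxu] at hxy
  have hyu : y = ClassicalState.unif y.top y.top_nonempty := ClassicalState.eq_unif fun i hi =>
    ClassicalState.prob_eq_zero_of_unif_le hn hxy (by rwa [htop])
  rw [hx, hxu, ClassicalState.unif_congr htop _ y.top_nonempty, ← hyu]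
  exact hy

/-- The uniform quantum states form a uniform system indexed by the nonzero subspaces. -/
def uniformSystem (hn : 2 ≤ finrank ℂ H) : UniformSystem (QuantumState H) (Submodule ℂ H) where
  u K := unif K.1 K.2
  t ρ := ⟨ρ.top, ρ.top_ne_bot⟩
  le_u_iff ρ K := le_unif_iff hn ρ K.1 K.2
  t_u _ := Subtype.ext (top_unif _ _)
  t_le_of_u_le _ _ h := top_le_of_unif_le hn h
  eq_u_of_u_le _ h := eq_unif_of_unif_top_le hn h

end QuantumState

end StateDomains

end

theorem mainTheorem1 (n : ℕ) (hn : 2 ≤ n) :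
    Nonempty ((StateDomains.Ir (StateDomains.ClassicalState n))ᵒᵈ ≃o
      {S : Set (Fin n) // S ≠ ∅}) ∧
    ∀ (H : Type*) [NormedAddCommGroup H] [InnerProductSpace ℂ H] [FiniteDimensional ℂ H],
      Module.finrank ℂ H = n →
        Nonempty ((StateDomains.Ir (StateDomains.QuantumState H))ᵒᵈ ≃o
          {K : Submodule ℂ H // K ≠ ⊥}) := by
  refine ⟨⟨(StateDomains.ClassicalState.uniformSystem hn).irIso⟩, ?_⟩
  rintro H _ _ _ rfl
  exact ⟨(StateDomains.QuantumState.uniformSystem hn).irIso⟩
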